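/- Work over $\mathbb{C}$. For $1\le r\le n$ let $\sigma_{r,n}\subset\mathbb{P}(\mathbb{C}^{n\times n})$ be the variety of $n\times n$ matrices of rank at most $r$, up to scale. For a finite set $S$ of matrix positions (pairs $(i,j)$ of indices) contained in $[n]\times[n]$, let $L^S\subset\mathbb{P}(\mathbb{C}^{n\times n})$ be the projective linear space of nonzero matrices, up to scale, all of whose nonzero entries are at positions in $S$. The join $J(X,Y)$ of $X,Y\subset\mathbb{P}V$ is the Zariski closure of the union of all lines $\langle x,y\rangle$ with $x\in X$, $y\in Y$, $x\ne y$. A hypersurface is a projective variety of codimension one; its degree is the degree of its defining equation, i.e. of a homogeneous generator of its ideal. Fix an integer $k\ge 2$ and a set $S$ of positions with $|S|=k^2-1$. Then there is a constant $C$, depending only on $k$ and $S$, such that for every $n>k$ with $S\subset[n]\times[n]$ for which $J(\sigma_{n-k,n},L^S)\subset\mathbb{P}(\mathbb{C}^{n\times n})$ is a hypersurface, $$\deg J(\sigma_{n-k,n},L^S)\le C\,n .$$ -/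

import Mathlib

open scoped LinearAlgebra.Projectivization

noncomputable section

namespace RigidityJoin

/-! ### Projective geometry in the space of lines through the origin of `ℂ^ι` -/

section Projective

variable {ι : Type} [Fintype ι]

/-- The affine cone over `Z`: the union of the lines in `Z`, together with the origin. -/
def affineCone (Z : Set (ℙ ℂ (ι → ℂ))) : Set (ι → ℂ) :=
  {v | v = 0 ∨ ∃ z ∈ Z, v ∈ z.submodule}

/-- The ideal of `Z`: all polynomials that vanish on the affine cone over `Z`. -/
def idealOf (Z : Set (ℙ ℂ (ι → ℂ))) : Ideal (MvPolynomial ι ℂ) :=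
  MvPolynomial.vanishingIdeal ℂ (affineCone Z)

/-- The Zariski closure of `Z`: the common zero set of all polynomials vanishing on `Z`. -/
def zariskiClosure (Z : Set (ℙ ℂ (ι → ℂ))) : Set (ℙ ℂ (ι → ℂ)) :=
  {z | (z.submodule : Set (ι → ℂ)) ⊆ MvPolynomial.zeroLocus ℂ (idealOf Z)}

/-- The projective linear space of lines contained in the linear subspace `W`. -/
def linearSpace (W : Submodule ℂ (ι → ℂ)) : Set (ℙ ℂ (ι → ℂ)) :=
  {z | z.submodule ≤ W}

/-- The union of the lines `⟨x, y⟩` with `x ∈ X`, `y ∈ Y`, `x ≠ y`. -/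
def openJoin (X Y : Set (ℙ ℂ (ι → ℂ))) : Set (ℙ ℂ (ι → ℂ)) :=
  {z | ∃ x ∈ X, ∃ y ∈ Y, x ≠ y ∧ z ∈ linearSpace (x.submodule ⊔ y.submodule)}

/-- The join of `X` and `Y`. -/
def join (X Y : Set (ℙ ℂ (ι → ℂ))) : Set (ℙ ℂ (ι → ℂ)) :=
  zariskiClosure (openJoin X Y)

/-- `c` is the codimension of the projective variety `Z`: the smallest natural number such that
every linear `ℙ^c` meets `Z`. -/
def HasCodimension (Z : Set (ℙ ℂ (ι → ℂ))) (c : ℕ) : Prop :=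
  IsLeast {c : ℕ | ∀ W : Submodule ℂ (ι → ℂ), Module.finrank ℂ W = c + 1 →
    (Z ∩ linearSpace W).Nonempty} c

/-- A hypersurface is a projective variety (a Zariski closed set) of codimension one. -/
def IsHypersurface (Z : Set (ℙ ℂ (ι → ℂ))) : Prop :=
  zariskiClosure Z = Z ∧ HasCodimension Z 1

/-- `d` is the degree of the hypersurface `Z`, that is, the degree of its defining equation:
the ideal of `Z` is generated by a single nonzero homogeneous polynomial of degree `d`. -/
def HasHypersurfaceDegree (Z : Set (ℙ ℂ (ι → ℂ))) (d : ℕ) : Prop :=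
  ∃ P : MvPolynomial ι ℂ, P ≠ 0 ∧ P.IsHomogeneous d ∧ idealOf Z = Ideal.span {P}

end Projective

/-! ### Matrices -/

/-- `σ_{r,n}`: the `n × n` matrices of rank at most `r`, up to scale. -/
def sigma (r n : ℕ) : Set (ℙ ℂ (Fin n × Fin n → ℂ)) :=
  {z | ∀ v ∈ z.submodule, (Matrix.of fun i j => v (i, j)).rank ≤ r}

/-- `L^S` in the space of `n × n` matrices: the projective linear space spanned by the matrix
units at the positions in `S`. Positions are pairs (row, column) of natural numbers, counted
from zero, so that the same `S` makes sense for every sufficiently large `n`. -/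
def entrySpace (S : Finset (ℕ × ℕ)) (n : ℕ) : Set (ℙ ℂ (Fin n × Fin n → ℂ)) :=
  linearSpace (Submodule.span ℂ
    {v | ∃ p : Fin n × Fin n, ((p.1 : ℕ), (p.2 : ℕ)) ∈ S ∧ v = Pi.single p (1 : ℂ)})

end RigidityJoin

end

namespace RigidityJoin

/-! ### Elimination along a direction. -/

section Projective

variable {ι : Type}

open MvPolynomial

/-! Let `m` be the least size at which the join is a hypersurface, with equation `f`. For size `m +
l`, split a matrix into blocks `A, B, D, T`, with `T` the lower right `l × l` block. Where `T` is
invertible, passing to the Schur complement `A - B T⁻¹ D` lowers the rank by `l`. Since `S` lies in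
the block `A`, a perturbation supported on `S` passes unchanged to the complement. Hence `f`
vanishes on the Schur complement of every sum of a matrix of rank at most `m + l - k` and one
supported on `S`. Clearing denominators and multiplying by `det T` gives a nonzero polynomial in the
ideal of the larger join (`schurLift_mem_idealOf_join`, `schurLift_ne_zero`) of degree at most `l +
deg f * (l + 2)`. The equation in size `m + l` divides it, so its degree is linear in `l`.

That such an equation exists must be derived from the definition of codimension by linear sections.
The ideal of the join is prime, being the kernel of a map of polynomial rings
(`idealOf_join_isPrime`). If it contained two elements `P`, `Q` with `P` prime and not dividing `Q`,
projecting from a general point would put the image of their common zeros inside a hypersurface. A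
general line through that point would then miss the variety, contradicting codimension one
(`IsHypersurface.exists_idealOf_eq_span`). -/

theorem coeff_prod_sum_of_natDegree_le {R κ : Type*} [CommSemiring R] (s : Finset κ)
    (f : κ → Polynomial R) (d : κ → ℕ) (h : ∀ i, (f i).natDegree ≤ d i) :
    (∏ i ∈ s, f i).coeff (∑ i ∈ s, d i) = ∏ i ∈ s, (f i).coeff (d i) := by
  classical
  induction s using Finset.induction_on with
  | empty => simp
  | insert a s ha ih =>
    rw [Finset.prod_insert ha, Finset.sum_insert ha, Finset.prod_insert ha, ← ih]
    exact Polynomial.coeff_mul_add_eq_of_natDegree_le (h a)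
      ((Polynomial.natDegree_prod_le _ _).trans (Finset.sum_le_sum fun i _ => h i))

theorem eval_smul_of_isHomogeneous {P : MvPolynomial ι ℂ} {d : ℕ} (hP : P.IsHomogeneous d)
    (t : ℂ) (v : ι → ℂ) : eval (t • v) P = t ^ d * eval v P := by
  rw [eval_eq, eval_eq, Finset.mul_sum]
  refine Finset.sum_congr rfl fun s hs => ?_
  have hd : s.degree = d := by
    by_contra h
    exact mem_support_iff.1 hs (hP.coeff_eq_zero h)
  simp only [Pi.smul_apply, smul_eq_mul, mul_pow, Finset.prod_mul_distrib, Finset.prod_pow_eq_pow_sum]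
  rw [← Finsupp.degree_apply, hd]
  ring

/-- Substituting `x + t e` into `P` gives a polynomial in `t` of degree at most the total degree
of `P`, whose top coefficient is the value at `e` of the leading form of `P`. -/
theorem coeff_totalDegree_translate (P : MvPolynomial ι ℂ) (e : ι → ℂ) :
    (aeval (fun i => Polynomial.C (X i) + Polynomial.C (C (e i)) * Polynomial.X :
        ι → Polynomial (MvPolynomial ι ℂ)) P).natDegree ≤ P.totalDegree ∧
    (aeval (fun i => Polynomial.C (X i) + Polynomial.C (C (e i)) * Polynomial.X :
        ι → Polynomial (MvPolynomial ι ℂ)) P).coeff P.totalDegree =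
      C (eval e (homogeneousComponent P.totalDegree P)) := by
  have hlin : ∀ i, (Polynomial.C (X i) + Polynomial.C (C (e i)) * Polynomial.X :
      Polynomial (MvPolynomial ι ℂ)).natDegree ≤ 1 := fun i => by
    rw [add_comm]
    exact Polynomial.natDegree_linear_le
  have hpow : ∀ (s : ι →₀ ℕ) (i : ι),
      ((Polynomial.C (X i) + Polynomial.C (C (e i)) * Polynomial.X :
        Polynomial (MvPolynomial ι ℂ)) ^ s i).natDegree ≤ s i := fun s i =>
    (Polynomial.natDegree_pow_le_of_le _ (hlin i)).trans (by simp)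
  have hdeg : ∀ s : ι →₀ ℕ,
      (∏ i ∈ s.support, (Polynomial.C (X i) + Polynomial.C (C (e i)) * Polynomial.X :
        Polynomial (MvPolynomial ι ℂ)) ^ s i).natDegree ≤ s.degree := fun s =>
    (Polynomial.natDegree_prod_le _ _).trans (Finset.sum_le_sum fun i _ => hpow s i)
  have hcoeff : ∀ s : ι →₀ ℕ,
      (∏ i ∈ s.support, (Polynomial.C (X i) + Polynomial.C (C (e i)) * Polynomial.X :
        Polynomial (MvPolynomial ι ℂ)) ^ s i).coeff s.degree =
        C (∏ i ∈ s.support, e i ^ s i) := fun s => by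
    rw [Finsupp.degree_apply, coeff_prod_sum_of_natDegree_le _ _ _ (hpow s),
      map_prod]
    refine Finset.prod_congr rfl fun i _ => ?_
    have := Polynomial.coeff_pow_of_natDegree_le (n := 1) (m := s i) (hlin i)
    rw [mul_one] at this
    rw [this]
    simp
  have hle : ∀ s ∈ P.support, s.degree ≤ P.totalDegree := fun s hs => le_totalDegree hs
  rw [aeval_def, eval₂_eq]
  constructor
  · refine Polynomial.natDegree_sum_le_of_forall_le _ _ fun s hs => ?_
    refine (Polynomial.natDegree_C_mul_le _ _).trans ((hdeg s).trans (hle s hs))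
  · rw [Polynomial.finsetSum_coeff, homogeneousComponent_apply, map_sum, map_sum,
      Finset.sum_filter]
    refine Finset.sum_congr rfl fun s hs => ?_
    change (Polynomial.C (C (coeff s P)) * _).coeff _ = _
    rw [Polynomial.coeff_C_mul]
    split_ifs with h
    · rw [← h, hcoeff s, eval_monomial, C_mul]
      rfl
    · rw [Polynomial.coeff_eq_zero_of_natDegree_lt, mul_zero]
      exact (hdeg s).trans_lt (lt_of_le_of_ne (hle s hs) h)

/-- Elimination along the direction `e`: if `S` is a domain generated by the values `q f` and `t`,
and `P` is in general position with respect to `e`, then modulo `P` every `q Q ≠ 0` divides a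
nonzero polynomial in the coordinates projected along `e`. -/
theorem exists_dvd_aeval_sub_mul {S : Type*} [CommRing S] [IsDomain S] [Algebra ℂ S]
    (q : MvPolynomial ι ℂ →ₐ[ℂ] S) (t : S) {P Q : MvPolynomial ι ℂ} (hP : q P = 0) (hQ : q Q ≠ 0)
    (e : ι → ℂ) (he : eval e (homogeneousComponent P.totalDegree P) ≠ 0) :
    ∃ h : MvPolynomial ι ℂ, h ≠ 0 ∧ q Q ∣ aeval (fun i => q (X i) - algebraMap ℂ S (e i) * t) h := by
  let θ : MvPolynomial ι ℂ →ₐ[ℂ] S := aeval fun i => q (X i) - algebraMap ℂ S (e i) * t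
  obtain ⟨hdeg, hcoeff⟩ := coeff_totalDegree_translate P e
  set Φ : MvPolynomial ι ℂ →ₐ[ℂ] Polynomial (MvPolynomial ι ℂ) :=
    aeval (fun i => Polynomial.C (X i) + Polynomial.C (C (e i)) * Polynomial.X) with hΦ
  set c := eval e (homogeneousComponent P.totalDegree P) with hc
  -- The polynomial ring acts on `S` through the projected coordinates `q (X i) - e i * t`.
  let _ : Algebra (MvPolynomial ι ℂ) S := θ.toRingHom.toAlgebra
  have hθ : ∀ f, algebraMap (MvPolynomial ι ℂ) S f = θ f := fun _ => rfl
  let E : Polynomial (MvPolynomial ι ℂ) →+* S := Polynomial.eval₂RingHom θ.toRingHom t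
  have hEC : ∀ f, E (Polynomial.C f) = θ f := fun f => Polynomial.eval₂_C _ _
  have hEX : E Polynomial.X = t := Polynomial.eval₂_X _ _
  have hθC : ∀ a, θ (C a) = algebraMap ℂ S a := θ.commutes
  have hqC : ∀ a, q (C a) = algebraMap ℂ S a := q.commutes
  have hΦC : ∀ a, Φ (C a) = Polynomial.C (C a) := Φ.commutes
  have hroot : ∀ f, E (Φ f) = q f := by
    intro f
    induction f using MvPolynomial.induction_on with
    | C a => rw [hΦC, hEC, hθC, hqC]
    | add f g hf hg => rw [map_add, map_add, map_add, hf, hg]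
    | mul_X f i hf =>
      rw [map_mul, map_mul, map_mul, hf, hΦ, aeval_X, map_add, map_mul, hEC, hEC, hEX, hθC, aeval_X,
        sub_add_cancel]
  -- Expanding `q P = 0` in powers of `t` gives an integral equation: the top coefficient is the
  -- nonzero constant `c`.
  have ht : IsIntegral (MvPolynomial ι ℂ) t := by
    refine ⟨Polynomial.C (C c⁻¹) * Φ P,
      Polynomial.monic_of_natDegree_le_of_coeff_eq_one P.totalDegree
        ((Polynomial.natDegree_C_mul_le _ _).trans hdeg) ?_, ?_⟩
    · rw [Polynomial.coeff_C_mul, hcoeff, ← C_mul, inv_mul_cancel₀ he, C_1]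
    · change E _ = 0
      rw [map_mul, hroot, hP, mul_zero]
  have hC : ∀ a, IsIntegral (MvPolynomial ι ℂ) (algebraMap ℂ S a) := fun a => by
    rw [← hθC a, ← hθ]
    exact isIntegral_algebraMap
  have hint : ∀ f, IsIntegral (MvPolynomial ι ℂ) (q f) := by
    intro f
    induction f using MvPolynomial.induction_on with
    | C a => rw [hqC]; exact hC a
    | add f g hf hg => rw [map_add]; exact hf.add hg
    | mul_X f i hf =>
      rw [map_mul]
      refine hf.mul ?_
      have : q (X i) = θ (X i) + algebraMap ℂ S (e i) * t := by
        rw [aeval_X, sub_add_cancel]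
      rw [this, ← hθ]
      exact isIntegral_algebraMap.add ((hC _).mul ht)
  -- In a domain, an ideal containing a nonzero integral element contracts to a nonzero ideal.
  obtain ⟨h, hh, hh0⟩ := Submodule.exists_mem_ne_zero_of_ne_bot
    (Ideal.comap_ne_bot_of_integral_mem hQ (Ideal.mem_span_singleton_self _) (hint Q))
  exact ⟨h, hh0, Ideal.mem_span_singleton.1 (Ideal.mem_comap.1 hh)⟩

/-- Two polynomials without common factor, one of which is in general position with respect to
`e`, have common zeros whose projection along `e` lies in a hypersurface. -/
theorem exists_eliminant {P Q : MvPolynomial ι ℂ} (hP : Prime P) (hPQ : ¬ P ∣ Q) (e : ι → ℂ)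
    (he : eval e (homogeneousComponent P.totalDegree P) ≠ 0) :
    ∃ h : MvPolynomial ι ℂ, h ≠ 0 ∧
      ∀ (v : ι → ℂ) (t : ℂ), eval v P = 0 → eval v Q = 0 → eval (fun i => v i - t * e i) h = 0 := by
  let J : Ideal (MvPolynomial ι ℂ) := Ideal.span {P}
  have hJ : J.IsPrime := (Ideal.span_singleton_prime hP.ne_zero).2 hP
  -- A free variable serves as `t`, so one `h` works for all points `v - t * e` on the line of
  -- direction `e` through `v`.
  let q : MvPolynomial ι ℂ →ₐ[ℂ] Polynomial (MvPolynomial ι ℂ ⧸ J) :=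
    (IsScalarTower.toAlgHom ℂ (MvPolynomial ι ℂ ⧸ J) (Polynomial (MvPolynomial ι ℂ ⧸ J))).comp
      (Ideal.Quotient.mkₐ ℂ J)
  have hq : ∀ f, q f = Polynomial.C (Ideal.Quotient.mk J f) := fun _ => rfl
  have hq0 : ∀ f, q f = 0 ↔ P ∣ f := fun f => by
    rw [hq, Polynomial.C_eq_zero, Ideal.Quotient.eq_zero_iff_mem, Ideal.mem_span_singleton]
  obtain ⟨h, hh0, g, hg⟩ := exists_dvd_aeval_sub_mul
    (S := Polynomial (MvPolynomial ι ℂ ⧸ J)) q Polynomial.X (P := P) (Q := Q) ((hq0 P).2 dvd_rfl)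
    ((hq0 Q).not.2 hPQ) e he
  refine ⟨h, hh0, fun v t hvP hvQ => ?_⟩
  let ev : MvPolynomial ι ℂ ⧸ J →ₐ[ℂ] ℂ := Ideal.Quotient.liftₐ J (aeval v) fun a ha => by
    obtain ⟨b, rfl⟩ := Ideal.mem_span_singleton.1 ha
    rw [map_mul, aeval_eq_eval, hvP, zero_mul]
  let Ev : Polynomial (MvPolynomial ι ℂ ⧸ J) →+* ℂ := Polynomial.eval₂RingHom ev.toRingHom t
  have hEv : ∀ f, Ev (q f) = eval v f := fun f => Polynomial.eval₂_C _ _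
  have hEX : Ev Polynomial.X = t := Polynomial.eval₂_X _ _
  have hEC : ∀ a, Ev (algebraMap ℂ _ a) = a := fun a => by
    rw [← q.commutes, MvPolynomial.algebraMap_eq, hEv, eval_C]
  have hEθ : ∀ f, Ev (aeval (fun i => q (X i) - algebraMap ℂ _ (e i) * Polynomial.X) f) =
      eval (fun i => v i - t * e i) f := by
    intro f
    induction f using MvPolynomial.induction_on with
    | C a => rw [eval_C, aeval_C, hEC]
    | add f g hf hg => rw [map_add, map_add, map_add, hf, hg]
    | mul_X f i hf =>
      rw [map_mul, map_mul, map_mul, hf, aeval_X, map_sub, map_mul, hEv, hEC, hEX, eval_X, eval_X,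
        mul_comm t]
  rw [← hEθ, hg, map_mul, hEv, hvQ, zero_mul]

/-! ### Homogeneous ideals and hypersurfaces. -/

theorem mem_idealOf {Z : Set (ℙ ℂ (ι → ℂ))} {f : MvPolynomial ι ℂ} :
    f ∈ idealOf Z ↔ ∀ v ∈ affineCone Z, eval v f = 0 := by
  rw [idealOf, mem_vanishingIdeal_iff]
  rfl

theorem smul_mem_affineCone {Z : Set (ℙ ℂ (ι → ℂ))} {v : ι → ℂ} (hv : v ∈ affineCone Z) (t : ℂ) :
    t • v ∈ affineCone Z := by
  rcases hv with rfl | ⟨z, hz, hv⟩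
  · exact Or.inl (smul_zero t)
  · exact Or.inr ⟨z, hz, z.submodule.smul_mem t hv⟩

/-- The cone is stable under scaling, so `f (t • v)` vanishes identically in `t`; its coefficients
are the values at `v` of the components of `f`. -/
theorem homogeneousComponent_mem_idealOf {Z : Set (ℙ ℂ (ι → ℂ))} {f : MvPolynomial ι ℂ}
    (hf : f ∈ idealOf Z) (i : ℕ) : homogeneousComponent i f ∈ idealOf Z := by
  rw [mem_idealOf] at hf ⊢
  intro v hv
  have key : (∑ j ∈ Finset.range (f.totalDegree + 1),
      Polynomial.C (eval v (homogeneousComponent j f)) * Polynomial.X ^ j) = 0 := by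
    refine Polynomial.funext fun t => ?_
    rw [Polynomial.eval_zero, ← hf _ (smul_mem_affineCone hv t)]
    conv_rhs => rw [← sum_homogeneousComponent f]
    rw [Polynomial.eval_finsetSum, map_sum]
    refine Finset.sum_congr rfl fun j _ => ?_
    rw [eval_smul_of_isHomogeneous (homogeneousComponent_isHomogeneous j f), Polynomial.eval_mul,
      Polynomial.eval_C, Polynomial.eval_pow, Polynomial.eval_X, mul_comm]
  by_cases hi : f.totalDegree < i
  · rw [homogeneousComponent_eq_zero _ _ hi, map_zero]
  · have := congrArg (fun p => Polynomial.coeff p i) key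
    simp only [Polynomial.finsetSum_coeff, Polynomial.coeff_C_mul, Polynomial.coeff_X_pow,
      mul_ite, mul_one, mul_zero, Polynomial.coeff_zero] at this
    rwa [Finset.sum_ite_eq, if_pos (Finset.mem_range.2 (by omega))] at this

theorem homogeneousComponent_totalDegree_ne_zero {P : MvPolynomial ι ℂ} (hP : P ≠ 0) :
    homogeneousComponent P.totalDegree P ≠ 0 := by
  obtain ⟨s, hs, hd⟩ := Finset.exists_mem_eq_sup P.support (support_nonempty.2 hP)
    fun s => s.degree
  intro h
  have := congrArg (coeff s) h
  rw [coeff_homogeneousComponent, if_pos, coeff_zero] at this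
  · exact mem_support_iff.1 hs this
  · exact hd.symm

/-- A generator of a principal homogeneous ideal is homogeneous. -/
theorem isHomogeneous_of_idealOf_eq_span {Z : Set (ℙ ℂ (ι → ℂ))} {P : MvPolynomial ι ℂ}
    (hZ : idealOf Z = Ideal.span {P}) : P.IsHomogeneous P.totalDegree := by
  have hcomp : ∀ i < P.totalDegree, homogeneousComponent i P = 0 := by
    intro i hi
    by_contra h0
    have hdvd : P ∣ homogeneousComponent i P := by
      rw [← Ideal.mem_span_singleton, ← hZ]
      exact homogeneousComponent_mem_idealOf (hZ ▸ Ideal.mem_span_singleton_self P) i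
    have h1 := totalDegree_le_of_dvd_of_isDomain hdvd h0
    have h2 := (homogeneousComponent_isHomogeneous i P).totalDegree_le
    omega
  have : P = homogeneousComponent P.totalDegree P := by
    conv_lhs => rw [← sum_homogeneousComponent P]
    rw [Finset.sum_range_succ, Finset.sum_eq_zero, zero_add]
    exact fun i hi => hcomp i (Finset.mem_range.1 hi)
  rw [this]
  have h := homogeneousComponent_isHomogeneous P.totalDegree P
  rwa [← this] at h ⊢

/-- A hypersurface in the sense of dimension theory whose ideal is prime is the zero set of a
single homogeneous equation generating its ideal. -/
theorem IsHypersurface.exists_idealOf_eq_span [Nontrivial ι] {Z : Set (ℙ ℂ (ι → ℂ))}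
    (hZ : IsHypersurface Z) (hI : (idealOf Z).IsPrime) :
    ∃ P : MvPolynomial ι ℂ, P ≠ 0 ∧ idealOf Z = Ideal.span {P} := by
  obtain ⟨hclosed, hmeet, hleast⟩ := hZ
  -- A zero ideal would make the closed set `Z` the whole space, of codimension zero.
  have hne : idealOf Z ≠ ⊥ := by
    intro hbot
    have h0 : ¬ (1 ≤ 0) := by norm_num
    refine h0 (hleast fun W hW => ?_)
    rw [zero_add] at hW
    refine ⟨Projectivization.mk'' W hW, ?_, (Projectivization.submodule_mk'' W hW).le⟩
    rw [← hclosed]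
    intro v _
    rw [hbot]
    intro p hp
    rw [(Submodule.mem_bot _).1 hp, map_zero]
  classical
  obtain ⟨P, hPI, hP⟩ := hI.exists_mem_prime_of_ne_bot hne
  refine ⟨P, hP.ne_zero, le_antisymm (fun Q hQ => ?_) ((Ideal.span_singleton_le_iff_mem _).2 hPI)⟩
  rw [Ideal.mem_span_singleton]
  by_contra hPQ
  obtain ⟨i, j, hij⟩ := exists_pair_ne ι
  have htop := homogeneousComponent_totalDegree_ne_zero hP.ne_zero
  -- The factor `X i` ensures `e i ≠ 0`, so that the form `e i * x j - e j * x i` is nonzero and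
  -- detects independence from `e`.
  obtain ⟨e, he⟩ : ∃ e, eval e (homogeneousComponent P.totalDegree P * X i) ≠ 0 := by
    by_contra! h
    exact mul_ne_zero htop (X_ne_zero i) (MvPolynomial.funext fun x => by rw [h x, map_zero])
  rw [map_mul, eval_X] at he
  have he1 := left_ne_zero_of_mul he
  have hei := right_ne_zero_of_mul he
  obtain ⟨h, hh0, hh⟩ := exists_eliminant hP hPQ e he1
  have hl0 : (C (e i) * X j - C (e j) * X i : MvPolynomial ι ℂ) ≠ 0 := by
    intro h0
    have := congrArg (eval (fun a => if a = j then (1 : ℂ) else 0)) h0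
    simp [hij, hei] at this
  obtain ⟨w, hw⟩ : ∃ w, eval w (h * (C (e i) * X j - C (e j) * X i)) ≠ 0 := by
    by_contra! h'
    exact mul_ne_zero hh0 hl0 (MvPolynomial.funext fun x => by rw [h' x, map_zero])
  rw [map_mul] at hw
  have hhw := left_ne_zero_of_mul hw
  have hlw := right_ne_zero_of_mul hw
  simp only [map_sub, map_mul, eval_C, eval_X] at hlw
  have hli : LinearIndependent ℂ ![w, e] := by
    rw [LinearIndependent.pair_iff]
    intro s t hst
    have h1 : s * w i + t * e i = 0 := congrFun hst i
    have h2 : s * w j + t * e j = 0 := congrFun hst j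
    have hs : s = 0 := by
      have : s * (e i * w j - e j * w i) = 0 := by linear_combination e i * h2 - e j * h1
      exact (mul_eq_zero.1 this).resolve_right hlw
    rw [hs, zero_mul, zero_add] at h1
    exact ⟨hs, (mul_eq_zero.1 h1).resolve_right hei⟩
  obtain ⟨z, hzZ, hzW⟩ := hmeet (Submodule.span ℂ (Set.range ![w, e])) (by
    rw [finrank_span_eq_card hli]; rfl)
  have hvan : ∀ f ∈ idealOf Z, ∀ v ∈ z.submodule, eval v f = 0 := fun f hf v hv =>
    mem_idealOf.1 hf v (Or.inr ⟨z, hzZ, hv⟩)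
  have hrep : z.rep ∈ z.submodule := by
    rw [Projectivization.submodule_eq]
    exact Submodule.mem_span_singleton_self _
  have hmem := hzW hrep
  rw [Matrix.range_cons, Matrix.range_cons, Matrix.range_empty, Set.union_empty,
    Set.singleton_union, Submodule.mem_span_pair] at hmem
  obtain ⟨a, b, hab⟩ := hmem
  -- Either the common point is the centre `[e]`, where the leading form of `P` does not vanish, or
  -- it rescales to `w + t • e`, which projects to `w`, where `h` does not vanish.
  by_cases ha : a = 0
  · have hb : b ≠ 0 := by
      rintro rfl
      refine z.rep_nonzero ?_
      rw [← hab, ha, zero_smul, zero_smul, add_zero]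
    refine he1 (hvan _ (homogeneousComponent_mem_idealOf hPI _) e ?_)
    have : e = b⁻¹ • z.rep := by
      rw [← hab, ha, zero_smul, zero_add, inv_smul_smul₀ hb]
    rw [this]
    exact z.submodule.smul_mem _ hrep
  · have hv : a⁻¹ • z.rep ∈ z.submodule := z.submodule.smul_mem _ hrep
    have := hh _ (a⁻¹ * b) (hvan P hPI _ hv) (hvan Q hQ _ hv)
    refine hhw ?_
    have hpt : w = fun l => (a⁻¹ • z.rep) l - a⁻¹ * b * e l := by
      funext l
      rw [← hab]
      simp only [Pi.smul_apply, Pi.add_apply, smul_eq_mul]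
      field_simp
      ring
    rwa [← hpt] at this

/-! ### Affine cones over joins. -/

theorem affineCone_linearSpace (W : Submodule ℂ (ι → ℂ)) : affineCone (linearSpace W) = W := by
  ext v
  constructor
  · rintro (rfl | ⟨z, hz, hv⟩)
    · exact W.zero_mem
    · exact hz hv
  · intro hv
    by_cases h0 : v = 0
    · exact Or.inl h0
    · refine Or.inr ⟨Projectivization.mk ℂ v h0, ?_, ?_⟩
      · rw [linearSpace, Set.mem_ofPred_eq, Projectivization.submodule_mk,
          Submodule.span_singleton_le_iff_mem]
        exact hv
      · rw [Projectivization.submodule_mk]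
        exact Submodule.mem_span_singleton_self v

/-- The affine cone over a join is, up to Zariski closure, the sum of the affine cones. -/
theorem mem_idealOf_join {X Y : Set (ℙ ℂ (ι → ℂ))} (hX : X.Nontrivial) (hY : Y.Nontrivial)
    {f : MvPolynomial ι ℂ} :
    f ∈ idealOf (join X Y) ↔ ∀ x ∈ affineCone X, ∀ y ∈ affineCone Y, eval (x + y) f = 0 := by
  constructor
  · intro hf x hx y hy
    by_cases h0 : x + y = 0
    · exact mem_idealOf.1 hf _ (Or.inl h0)
    -- When a summand is zero or both lie on the same line, a second point of `X` or `Y` is needed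
    -- to have distinct points to join.
    have key : ∃ a ∈ X, ∃ b ∈ Y, a ≠ b ∧ x + y ∈ a.submodule ⊔ b.submodule := by
      rcases hx with rfl | ⟨a, ha, hxa⟩ <;> rcases hy with rfl | ⟨b, hb, hyb⟩
      · exact absurd (add_zero 0) h0
      · obtain ⟨a, ha, hab⟩ := hX.exists_ne b
        exact ⟨a, ha, b, hb, hab, by rw [zero_add]; exact Submodule.mem_sup_right hyb⟩
      · obtain ⟨b, hb, hba⟩ := hY.exists_ne a
        exact ⟨a, ha, b, hb, hba.symm, by rw [add_zero]; exact Submodule.mem_sup_left hxa⟩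
      · by_cases hab : a = b
        · subst hab
          obtain ⟨b', hb', hba⟩ := hY.exists_ne a
          exact ⟨a, ha, b', hb', hba.symm,
            Submodule.mem_sup_left (a.submodule.add_mem hxa hyb)⟩
        · exact ⟨a, ha, b, hb, hab, Submodule.add_mem_sup hxa hyb⟩
    obtain ⟨a, ha, b, hb, hab, hmem⟩ := key
    have hopen : Projectivization.mk ℂ (x + y) h0 ∈ openJoin X Y := by
      refine ⟨a, ha, b, hb, hab, ?_⟩
      rw [linearSpace, Set.mem_ofPred_eq, Projectivization.submodule_mk,
        Submodule.span_singleton_le_iff_mem]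
      exact hmem
    refine mem_idealOf.1 hf _ (Or.inr ⟨Projectivization.mk ℂ (x + y) h0, ?_, ?_⟩)
    · exact fun v hv p hp => mem_idealOf.1 hp v (Or.inr ⟨_, hopen, hv⟩)
    · rw [Projectivization.submodule_mk]
      exact Submodule.mem_span_singleton_self _
  · intro hf
    have hf0 : eval 0 f = 0 := by
      simpa using hf 0 (Or.inl rfl) 0 (Or.inl rfl)
    have hopen : f ∈ idealOf (openJoin X Y) := by
      refine mem_idealOf.2 ?_
      rintro v (rfl | ⟨z, ⟨a, ha, b, hb, -, hz⟩, hv⟩)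
      · exact hf0
      · obtain ⟨x, hx, y, hy, rfl⟩ := Submodule.mem_sup.1 (hz hv)
        exact hf x (Or.inr ⟨a, ha, hx⟩) y (Or.inr ⟨b, hb, hy⟩)
    refine mem_idealOf.2 ?_
    rintro v (rfl | ⟨z, hz, hv⟩)
    · exact hf0
    · exact hz hv f hopen

end Projective

end RigidityJoin
namespace RigidityJoin

/-! ### Bounded rank, sparse matrices and irreducibility of their join. -/

section Matrices

open MvPolynomial

theorem affineCone_sigma (r n : ℕ) :
    affineCone (sigma r n) = {v | (Matrix.of fun i j => v (i, j)).rank ≤ r} := by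
  ext v
  constructor
  · rintro (rfl | ⟨z, hz, hv⟩)
    · have : (Matrix.of fun i j => (0 : Fin n × Fin n → ℂ) (i, j)) = 0 := rfl
      rw [Set.mem_ofPred_eq, this, Matrix.rank_zero]
      exact Nat.zero_le r
    · exact hz v hv
  · intro hv
    by_cases h0 : v = 0
    · exact Or.inl h0
    · refine Or.inr ⟨Projectivization.mk ℂ v h0, fun w hw => ?_, ?_⟩
      · rw [Projectivization.submodule_mk] at hw
        obtain ⟨c, rfl⟩ := Submodule.mem_span_singleton.1 hw
        have : (Matrix.of fun i j => (c • v) (i, j)) =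
            (c • (1 : Matrix (Fin n) (Fin n) ℂ)) * Matrix.of fun i j => v (i, j) := by
          rw [Matrix.smul_mul, Matrix.one_mul]
          rfl
        rw [this]
        exact (Matrix.rank_mul_le_right _ _).trans hv
      · rw [Projectivization.submodule_mk]
        exact Submodule.mem_span_singleton_self v

theorem mem_affineCone_entrySpace {S : Finset (ℕ × ℕ)} {n : ℕ} {y : Fin n × Fin n → ℂ} :
    y ∈ affineCone (entrySpace S n) ↔
      ∀ p : Fin n × Fin n, ((p.1 : ℕ), (p.2 : ℕ)) ∉ S → y p = 0 := by
  rw [entrySpace, affineCone_linearSpace, SetLike.mem_coe]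
  constructor
  · intro hy p hp
    induction hy using Submodule.span_induction with
    | mem v hv =>
      obtain ⟨q, hq, rfl⟩ := hv
      refine Pi.single_eq_of_ne ?_ _
      rintro rfl
      exact hp hq
    | zero => rfl
    | add v w _ _ hv hw => rw [Pi.add_apply, hv, hw, add_zero]
    | smul c v _ hv => rw [Pi.smul_apply, hv, smul_zero]
  · intro hy
    rw [pi_eq_sum_univ' y]
    refine Submodule.sum_mem _ fun p _ => ?_
    by_cases hp : ((p.1 : ℕ), (p.2 : ℕ)) ∈ S
    · refine Submodule.smul_mem _ _ (Submodule.subset_span ⟨p, hp, ?_⟩)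
      ext q
      simp [Pi.single_apply, eq_comm]
    · rw [hy p hp, zero_smul]
      exact Submodule.zero_mem _

theorem nontrivial_of_single_mem_affineCone {ι : Type} [DecidableEq ι] {Z : Set (ℙ ℂ (ι → ℂ))}
    {p q : ι} (hpq : p ≠ q) (hp : Pi.single p 1 ∈ affineCone Z)
    (hq : Pi.single q 1 ∈ affineCone Z) : Z.Nontrivial := by
  have hne : ∀ a : ι, (Pi.single a 1 : ι → ℂ) ≠ 0 := fun a => by simp
  rcases hp with h | ⟨x, hx, hpx⟩
  · exact absurd h (hne p)
  rcases hq with h | ⟨y, hy, hqy⟩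
  · exact absurd h (hne q)
  refine ⟨x, hx, y, hy, ?_⟩
  rintro rfl
  rw [Projectivization.submodule_eq] at hpx hqy
  obtain ⟨a, ha⟩ := Submodule.mem_span_singleton.1 hpx
  obtain ⟨b, hb⟩ := Submodule.mem_span_singleton.1 hqy
  have h1 := congrFun ha p
  have h2 := congrFun ha q
  have h3 := congrFun hb q
  simp only [Pi.smul_apply, smul_eq_mul, Pi.single_eq_same, Pi.single_eq_of_ne hpq.symm] at h1 h2 h3
  rcases mul_eq_zero.1 h2 with h | h
  · rw [h, zero_mul] at h1
    exact zero_ne_one h1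
  · rw [h, mul_zero] at h3
    exact zero_ne_one h3

theorem sigma_nontrivial {r n : ℕ} (hr : 0 < r) (hn : 2 ≤ n) : (sigma r n).Nontrivial := by
  have key : ∀ p : Fin n × Fin n, Pi.single p 1 ∈ affineCone (sigma r n) := by
    intro p
    rw [affineCone_sigma]
    have : (Matrix.of fun i j => (Pi.single p (1 : ℂ) : Fin n × Fin n → ℂ) (i, j)) =
        Matrix.vecMulVec (Pi.single p.1 1) (Pi.single p.2 1) := by
      ext i j
      simp only [Matrix.of_apply, Matrix.vecMulVec_apply, Pi.single_apply, Prod.ext_iff]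
      split_ifs <;> simp_all
    rw [Set.mem_ofPred_eq, this]
    exact (Matrix.rank_vecMulVec_le _ _).trans hr
  have hne : ((⟨0, by omega⟩, ⟨0, by omega⟩) : Fin n × Fin n) ≠ (⟨0, by omega⟩, ⟨1, by omega⟩) := by
    simp
  exact nontrivial_of_single_mem_affineCone hne (key _) (key _)

theorem entrySpace_nontrivial {S : Finset (ℕ × ℕ)} {n : ℕ} (hS : 1 < S.card)
    (hn : S ⊆ Finset.range n ×ˢ Finset.range n) : (entrySpace S n).Nontrivial := by
  obtain ⟨a, ha, b, hb, hab⟩ := Finset.one_lt_card.1 hS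
  have hlt : ∀ c ∈ S, c.1 < n ∧ c.2 < n := fun c hc => by
    simpa using Finset.mem_product.1 (hn hc)
  have key : ∀ (c : ℕ × ℕ) (hc : c ∈ S),
      Pi.single (⟨c.1, (hlt c hc).1⟩, ⟨c.2, (hlt c hc).2⟩) 1 ∈ affineCone (entrySpace S n) := by
    intro c hc
    rw [mem_affineCone_entrySpace]
    intro p hp
    refine Pi.single_eq_of_ne ?_ _
    rintro rfl
    exact hp hc
  refine nontrivial_of_single_mem_affineCone ?_ (key a ha) (key b hb)
  intro h
  simp only [Prod.mk.injEq, Fin.mk.injEq] at h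
  exact hab (Prod.ext h.1 h.2)

theorem exists_mul_of_rank_le {m r : ℕ} (M : Matrix (Fin m) (Fin m) ℂ) (h : M.rank ≤ r) :
    ∃ (U : Matrix (Fin m) (Fin r) ℂ) (V : Matrix (Fin r) (Fin m) ℂ), M = U * V := by
  let W := LinearMap.range M.mulVecLin
  let b : Module.Basis (Fin M.rank) ℂ W := Module.finBasisOfFinrankEq ℂ W rfl
  -- A basis of the column space, padded with zeros because the rank may be less than `r`.
  let w : Fin r → Fin m → ℂ := fun j => if hj : (j : ℕ) < M.rank then b ⟨j, hj⟩ else 0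
  have hw : W ≤ Submodule.span ℂ (Set.range w) := by
    intro x hx
    have hx' : x = ∑ i, b.repr ⟨x, hx⟩ i • (b i : Fin m → ℂ) := by
      exact (congrArg Subtype.val (b.sum_repr ⟨x, hx⟩)).symm.trans
        (by rw [Submodule.coe_sum]; rfl)
    rw [hx']
    refine Submodule.sum_mem _ fun i _ => Submodule.smul_mem _ _ (Submodule.subset_span ?_)
    exact ⟨Fin.castLE h i, by simp [w]⟩
  have hcol : ∀ j, ∃ c : Fin r → ℂ, ∑ i, c i • w i = M.col j := fun j => by
    rw [← Submodule.mem_span_range_iff_exists_fun]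
    refine hw ⟨Pi.single j 1, ?_⟩
    rw [Matrix.mulVecLin_apply, Matrix.mulVec_single_one]
  choose c hc using hcol
  refine ⟨Matrix.of fun i a => w a i, Matrix.of fun a j => c j a, ?_⟩
  ext i j
  have := congrFun (hc j) i
  rw [Matrix.col_apply] at this
  rw [← this, Matrix.mul_apply, Finset.sum_apply]
  exact Finset.sum_congr rfl fun a _ => mul_comm _ _

theorem mem_idealOf_join_sigma_entrySpace {r n : ℕ} (hr : 0 < r) (hn : 2 ≤ n)
    {S : Finset (ℕ × ℕ)} (hS : 1 < S.card) (hSn : S ⊆ Finset.range n ×ˢ Finset.range n)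
    {f : MvPolynomial (Fin n × Fin n) ℂ} :
    f ∈ idealOf (join (sigma r n) (entrySpace S n)) ↔
      ∀ x y : Fin n × Fin n → ℂ, (Matrix.of fun i j => x (i, j)).rank ≤ r →
        (∀ p : Fin n × Fin n, ((p.1 : ℕ), (p.2 : ℕ)) ∉ S → y p = 0) → eval (x + y) f = 0 := by
  rw [mem_idealOf_join (sigma_nontrivial hr hn) (entrySpace_nontrivial hS hSn), affineCone_sigma]
  exact ⟨fun h x y hx hy => h x hx y (mem_affineCone_entrySpace.2 hy),
    fun h x hx y hy => h x y hx (mem_affineCone_entrySpace.1 hy)⟩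

/-- The join is irreducible, being the closure of the image of an affine space. -/
theorem idealOf_join_isPrime {r n : ℕ} (hr : 0 < r) (hn : 2 ≤ n)
    {S : Finset (ℕ × ℕ)} (hS : 1 < S.card) (hSn : S ⊆ Finset.range n ×ˢ Finset.range n) :
    (idealOf (join (sigma r n) (entrySpace S n))).IsPrime := by
  let τ := (Fin n × Fin r) ⊕ (Fin r × Fin n) ⊕ (Fin n × Fin n)
  -- Pullback along the parametrization `(U, V, y) ↦ U * V + y`, with `y` cut down to `S`.
  let Φ : MvPolynomial (Fin n × Fin n) ℂ →ₐ[ℂ] MvPolynomial τ ℂ := aeval fun p =>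
    (∑ a, X (Sum.inl (p.1, a)) * X (Sum.inr (Sum.inl (a, p.2)))) +
      if ((p.1 : ℕ), (p.2 : ℕ)) ∈ S then X (Sum.inr (Sum.inr p)) else 0
  let low : (τ → ℂ) → Matrix (Fin n) (Fin n) ℂ := fun u =>
    (Matrix.of fun i a => u (Sum.inl (i, a))) * (Matrix.of fun a j => u (Sum.inr (Sum.inl (a, j))))
  let spr : (τ → ℂ) → Fin n × Fin n → ℂ := fun u p =>
    if ((p.1 : ℕ), (p.2 : ℕ)) ∈ S then u (Sum.inr (Sum.inr p)) else 0
  let pt : (τ → ℂ) → Fin n × Fin n → ℂ := fun u => (fun p => low u p.1 p.2) + spr u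
  have heval : ∀ (u : τ → ℂ) (f : MvPolynomial (Fin n × Fin n) ℂ),
      eval u (Φ f) = eval (pt u) f := by
    intro u f
    induction f using MvPolynomial.induction_on with
    | C a => rw [show Φ (C a) = C a from Φ.commutes a, eval_C, eval_C]
    | add f g hf hg => rw [map_add, map_add, map_add, hf, hg]
    | mul_X f p hf =>
      rw [map_mul, map_mul, map_mul, hf, aeval_X, eval_X]
      congr 1
      rw [map_add, map_sum]
      refine congrArg₂ (· + ·) (Finset.sum_congr rfl fun a _ => ?_) ?_
      · rw [map_mul, eval_X, eval_X]
        rfl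
      · split_ifs <;> simp [spr, *]
  have hker : idealOf (join (sigma r n) (entrySpace S n)) = RingHom.ker Φ := by
    ext f
    rw [mem_idealOf_join_sigma_entrySpace hr hn hS hSn, RingHom.mem_ker]
    constructor
    · intro hf
      refine MvPolynomial.funext fun u => ?_
      rw [heval, map_zero]
      have hlow : (low u).rank ≤ r :=
        (Matrix.rank_mul_le_left _ _).trans (Matrix.rank_le_width _)
      exact hf (fun p => low u p.1 p.2) (spr u) hlow fun p hp => if_neg hp
    · intro hf x y hx hy
      obtain ⟨U, V, hUV⟩ := exists_mul_of_rank_le _ hx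
      obtain ⟨u, hu⟩ : ∃ u, pt u = x + y := by
        refine ⟨Sum.elim (fun p => U p.1 p.2) (Sum.elim (fun p => V p.1 p.2) y), ?_⟩
        funext p
        refine congrArg₂ (· + ·) (congrFun (congrFun hUV p.1) p.2).symm ?_
        change (if ((p.1 : ℕ), (p.2 : ℕ)) ∈ S then y p else 0) = y p
        split_ifs with h
        · rfl
        · exact (hy p h).symm
      rw [← hu, ← heval, hf, map_zero]
  rw [hker]
  exact RingHom.ker_isPrime _

/-! ### Schur complements: rank and degree. -/

/-- The numerator of the Schur complement of the lower right `l × l` block. -/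
def schurNumerator {R : Type*} [CommRing R] {m l : ℕ} (N : Matrix (Fin (m + l)) (Fin (m + l)) R) :
    Matrix (Fin m) (Fin m) R :=
  (N.submatrix (Fin.natAdd m) (Fin.natAdd m)).det • N.submatrix (Fin.castAdd l) (Fin.castAdd l) -
    N.submatrix (Fin.castAdd l) (Fin.natAdd m) *
      (N.submatrix (Fin.natAdd m) (Fin.natAdd m)).adjugate *
      N.submatrix (Fin.natAdd m) (Fin.castAdd l)

theorem schurNumerator_map {R R' : Type*} [CommRing R] [CommRing R'] {m l : ℕ} (φ : R →+* R')
    (N : Matrix (Fin (m + l)) (Fin (m + l)) R) :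
    schurNumerator (N.map φ) = (schurNumerator N).map φ := by
  have hadj := φ.map_adjugate (N.submatrix (Fin.natAdd m) (Fin.natAdd m))
  have hdet := φ.map_det (N.submatrix (Fin.natAdd m) (Fin.natAdd m))
  rw [RingHom.mapMatrix_apply] at hdet
  rw [RingHom.mapMatrix_apply, RingHom.mapMatrix_apply] at hadj
  rw [schurNumerator, schurNumerator, Matrix.map_sub φ (map_sub φ), Matrix.map_mul, Matrix.map_mul,
    hadj, Matrix.map_smul' φ _ _ (map_mul φ), hdet]
  rfl

/-- Restricting a kernel vector of `N` to its first `m` coordinates gives a kernel vector of the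
numerator. Invertibility of the lower right block makes this restriction injective; comparing kernel
dimensions gives the bound. -/
theorem rank_schurNumerator_le {m l r : ℕ} (N : Matrix (Fin (m + l)) (Fin (m + l)) ℂ)
    (hT : (N.submatrix (Fin.natAdd m) (Fin.natAdd m)).det ≠ 0) (hN : N.rank ≤ r + l) :
    (schurNumerator N).rank ≤ r := by
  set T := N.submatrix (Fin.natAdd m : Fin l → _) (Fin.natAdd m : Fin l → _) with hTdef
  set A := N.submatrix (Fin.castAdd l) (Fin.castAdd l)
  set B := N.submatrix (Fin.castAdd l) (Fin.natAdd m : Fin l → _)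
  set D := N.submatrix (Fin.natAdd m : Fin l → _) (Fin.castAdd l)
  let res : (Fin (m + l) → ℂ) →ₗ[ℂ] (Fin m → ℂ) := LinearMap.funLeft ℂ ℂ (Fin.castAdd l)
  have hblock : ∀ w ∈ LinearMap.ker N.mulVecLin,
      A.mulVec (w ∘ Fin.castAdd l) + B.mulVec (w ∘ Fin.natAdd m) = 0 ∧
      D.mulVec (w ∘ Fin.castAdd l) + T.mulVec (w ∘ Fin.natAdd m) = 0 := by
    intro w hw
    rw [LinearMap.mem_ker, Matrix.mulVecLin_apply] at hw
    constructor
    · ext i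
      have := congrFun hw (Fin.castAdd l i)
      rw [Matrix.mulVec, dotProduct, Fin.sum_univ_add] at this
      exact this
    · ext i
      have := congrFun hw (Fin.natAdd m i)
      rw [Matrix.mulVec, dotProduct, Fin.sum_univ_add] at this
      exact this
  have hmaps : ∀ w ∈ LinearMap.ker N.mulVecLin,
      res w ∈ LinearMap.ker (schurNumerator N).mulVecLin := by
    intro w hw
    obtain ⟨h1, h2⟩ := hblock w hw
    rw [LinearMap.mem_ker, Matrix.mulVecLin_apply, schurNumerator, Matrix.sub_mulVec,
      Matrix.smul_mulVec, ← Matrix.mulVec_mulVec, ← Matrix.mulVec_mulVec]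
    change T.det • A.mulVec (w ∘ Fin.castAdd l) -
      B.mulVec (T.adjugate.mulVec (D.mulVec (w ∘ Fin.castAdd l))) = 0
    rw [eq_neg_of_add_eq_zero_left h1, eq_neg_of_add_eq_zero_left h2, Matrix.mulVec_neg,
      Matrix.mulVec_mulVec, Matrix.adjugate_mul, Matrix.smul_mulVec, Matrix.one_mulVec,
      Matrix.mulVec_neg, Matrix.mulVec_smul, smul_neg, sub_self]
  have hinj : Function.Injective (res.restrict hmaps) := by
    rw [← LinearMap.ker_eq_bot, LinearMap.ker_eq_bot']
    rintro ⟨w, hw⟩ h0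
    have hu : w ∘ Fin.castAdd l = 0 := congrArg Subtype.val h0
    have h2 := (hblock w hw).2
    rw [hu, Matrix.mulVec_zero, zero_add] at h2
    have hv := Matrix.eq_zero_of_mulVec_eq_zero hT h2
    ext i
    refine Fin.addCases (fun i => ?_) (fun i => ?_) i
    · exact congrFun hu i
    · exact congrFun hv i
  have h1 := LinearMap.finrank_le_finrank_of_injective hinj
  have h2 := LinearMap.finrank_range_add_finrank_ker N.mulVecLin
  have h3 := LinearMap.finrank_range_add_finrank_ker (schurNumerator N).mulVecLin
  rw [Module.finrank_fin_fun] at h2 h3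
  change N.rank + _ = _ at h2
  change (schurNumerator N).rank + _ = _ at h3
  omega

theorem totalDegree_det_le {κ : Type} {l b : ℕ} (N : Matrix (Fin l) (Fin l) (MvPolynomial κ ℂ))
    (h : ∀ i j, (N i j).totalDegree ≤ b) : N.det.totalDegree ≤ l * b := by
  rw [Matrix.det_apply]
  refine totalDegree_finsetSum_le fun σ _ => ?_
  rw [Units.smul_def, zsmul_eq_mul]
  refine (totalDegree_mul _ _).trans ?_
  rw [← map_intCast (C : ℂ →+* MvPolynomial κ ℂ), totalDegree_C, zero_add]
  refine (totalDegree_finsetProd _ _).trans ((Finset.sum_le_sum fun i _ => h _ _).trans ?_)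
  simp

/-- An entry of the adjugate is a determinant with one row replaced by constants, so the determinant
bound applies; the saving of one factor `b` is not needed. -/
theorem totalDegree_adjugate_le {κ : Type} {l b : ℕ}
    (N : Matrix (Fin l) (Fin l) (MvPolynomial κ ℂ))
    (h : ∀ i j, (N i j).totalDegree ≤ b) (i j : Fin l) : (N.adjugate i j).totalDegree ≤ l * b := by
  rw [Matrix.adjugate_apply]
  refine totalDegree_det_le _ fun i' j' => ?_
  rw [Matrix.updateRow_apply]
  split_ifs with hi
  · rw [Pi.single_apply]
    split_ifs <;> simp
  · exact h _ _

theorem totalDegree_mul_apply_le {κ : Type} {l m n a b : ℕ}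
    {M : Matrix (Fin m) (Fin l) (MvPolynomial κ ℂ)} {N : Matrix (Fin l) (Fin n) (MvPolynomial κ ℂ)}
    (hM : ∀ i j, (M i j).totalDegree ≤ a) (hN : ∀ i j, (N i j).totalDegree ≤ b)
    (i : Fin m) (j : Fin n) : ((M * N) i j).totalDegree ≤ a + b := by
  rw [Matrix.mul_apply]
  exact totalDegree_finsetSum_le fun k _ =>
    (totalDegree_mul _ _).trans (add_le_add (hM _ _) (hN _ _))

theorem totalDegree_schurNumerator_le {κ : Type} {m l : ℕ}
    (N : Matrix (Fin (m + l)) (Fin (m + l)) (MvPolynomial κ ℂ))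
    (h : ∀ i j, (N i j).totalDegree ≤ 1) (i j : Fin m) :
    (schurNumerator N i j).totalDegree ≤ l + 2 := by
  rw [schurNumerator, Matrix.sub_apply, Matrix.smul_apply, smul_eq_mul]
  refine (totalDegree_sub _ _).trans (max_le ?_ ?_)
  · refine (totalDegree_mul _ _).trans ((add_le_add (totalDegree_det_le (b := 1) _ fun _ _ => h _ _)
      (h _ _)).trans (by omega))
  · refine (totalDegree_mul_apply_le (totalDegree_mul_apply_le (fun _ _ => h _ _)
      (totalDegree_adjugate_le (b := 1) _ fun _ _ => h _ _)) (fun _ _ => h _ _) i j).trans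
      (by omega)

theorem totalDegree_aeval_le {κ κ' : Type} {D : ℕ} (g : κ → MvPolynomial κ' ℂ)
    (hg : ∀ i, (g i).totalDegree ≤ D) (f : MvPolynomial κ ℂ) :
    (aeval g f).totalDegree ≤ f.totalDegree * D := by
  rw [aeval_def, eval₂_eq]
  refine totalDegree_finsetSum_le fun s hs => (totalDegree_mul _ _).trans ?_
  rw [MvPolynomial.algebraMap_eq, totalDegree_C, zero_add]
  refine (totalDegree_finsetProd _ _).trans ?_
  refine le_trans (Finset.sum_le_sum fun i _ => (totalDegree_pow _ _).trans
    (Nat.mul_le_mul_left _ (hg i))) ?_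
  rw [← Finset.sum_mul]
  exact Nat.mul_le_mul_right _ (le_totalDegree hs)

/-! ### Lifting equations to larger matrices. -/

/-- An equation of the join in size `m` yields one in size `m + l`, by clearing denominators in
the Schur complement. -/
noncomputable def schurLift {m : ℕ} (l : ℕ) (f : MvPolynomial (Fin m × Fin m) ℂ) :
    MvPolynomial (Fin (m + l) × Fin (m + l)) ℂ :=
  ((Matrix.of fun i j => X (i, j) : Matrix (Fin (m + l)) (Fin (m + l)) (MvPolynomial
      (Fin (m + l) × Fin (m + l)) ℂ)).submatrix (Fin.natAdd m) (Fin.natAdd m)).det *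
    aeval (fun p => schurNumerator (Matrix.of fun i j => X (i, j)) p.1 p.2) f

theorem eval_schurLift {m l : ℕ} (f : MvPolynomial (Fin m × Fin m) ℂ)
    (v : Fin (m + l) × Fin (m + l) → ℂ) :
    eval v (schurLift l f) =
      ((Matrix.of fun i j => v (i, j)).submatrix (Fin.natAdd m) (Fin.natAdd m)).det *
        eval (fun p => schurNumerator (Matrix.of fun i j => v (i, j)) p.1 p.2) f := by
  have hmap : (Matrix.of fun i j => X (i, j) : Matrix (Fin (m + l)) (Fin (m + l)) (MvPolynomial
      (Fin (m + l) × Fin (m + l)) ℂ)).map (eval v) = Matrix.of fun i j => v (i, j) := by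
    ext i j
    simp
  rw [schurLift, map_mul, RingHom.map_det, RingHom.mapMatrix_apply, ← Matrix.submatrix_map, hmap,
    ← hmap, schurNumerator_map, hmap]
  congr 1
  induction f using MvPolynomial.induction_on with
  | C a => rw [aeval_C, MvPolynomial.algebraMap_eq, eval_C, eval_C]
  | add f g hf hg => rw [map_add, map_add, map_add, hf, hg]
  | mul_X f p hf => rw [map_mul, map_mul, map_mul, hf, aeval_X, eval_X, Matrix.map_apply]

/-- On the block diagonal matrix with blocks `u` and the identity, the lift takes the value of `f`
at `u`. -/
theorem schurLift_ne_zero {m l : ℕ} {f : MvPolynomial (Fin m × Fin m) ℂ} (hf : f ≠ 0) :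
    schurLift l f ≠ 0 := by
  obtain ⟨u, hu⟩ : ∃ u, eval u f ≠ 0 := by
    by_contra! h
    exact hf (MvPolynomial.funext fun x => by rw [h x, map_zero])
  intro h0
  let N : Matrix (Fin (m + l)) (Fin (m + l)) ℂ :=
    (Matrix.fromBlocks (Matrix.of fun i j => u (i, j)) 0 0 1).submatrix
      finSumFinEquiv.symm finSumFinEquiv.symm
  have hT : N.submatrix (Fin.natAdd m) (Fin.natAdd m) = 1 := by
    ext i j
    simp [N]
  have hA : N.submatrix (Fin.castAdd l) (Fin.castAdd l) = Matrix.of fun i j => u (i, j) := by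
    ext i j
    simp [N]
  have hB : N.submatrix (Fin.castAdd l) (Fin.natAdd m) = 0 := by
    ext i j
    simp [N]
  have hE : schurNumerator N = Matrix.of fun i j => u (i, j) := by
    rw [schurNumerator, hT, hA, hB, Matrix.det_one, one_smul, Matrix.zero_mul, Matrix.zero_mul,
      sub_zero]
  have := eval_schurLift (l := l) f fun p => N p.1 p.2
  rw [h0, map_zero] at this
  change 0 = (N.submatrix (Fin.natAdd m) (Fin.natAdd m)).det *
    eval (fun p => schurNumerator N p.1 p.2) f at this
  rw [hT, hE, Matrix.det_one, one_mul] at this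
  exact hu this.symm

theorem totalDegree_schurLift_le {m l : ℕ} (f : MvPolynomial (Fin m × Fin m) ℂ) :
    (schurLift l f).totalDegree ≤ l + f.totalDegree * (l + 2) := by
  have hX : ∀ i j, ((Matrix.of fun i j => X (i, j) : Matrix (Fin (m + l)) (Fin (m + l))
      (MvPolynomial (Fin (m + l) × Fin (m + l)) ℂ)) i j).totalDegree ≤ 1 := fun i j => by simp
  refine (totalDegree_mul _ _).trans (add_le_add ?_ ?_)
  · exact (totalDegree_det_le (b := 1) _ fun i j => hX _ _).trans (by rw [mul_one])
  · exact totalDegree_aeval_le _ (fun p => totalDegree_schurNumerator_le _ hX _ _) f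

/-- Adding `y` changes only the upper left block, so the numerator changes by `det T` times `y`,
again supported on `S`, while the rank bound drops from `r + l` to `r`. -/
theorem schurLift_mem_idealOf_join {r m : ℕ} (l : ℕ) (hr : 0 < r) (hm : 2 ≤ m)
    {S : Finset (ℕ × ℕ)} (hS : 1 < S.card) (hSm : S ⊆ Finset.range m ×ˢ Finset.range m)
    {f : MvPolynomial (Fin m × Fin m) ℂ}
    (hf : f ∈ idealOf (join (sigma r m) (entrySpace S m))) :
    schurLift l f ∈ idealOf (join (sigma (r + l) (m + l)) (entrySpace S (m + l))) := by
  have hSl : S ⊆ Finset.range (m + l) ×ˢ Finset.range (m + l) :=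
    hSm.trans (Finset.product_subset_product (Finset.range_mono (Nat.le_add_right m l))
      (Finset.range_mono (Nat.le_add_right m l)))
  rw [mem_idealOf_join_sigma_entrySpace hr hm hS hSm] at hf
  rw [mem_idealOf_join_sigma_entrySpace (by omega) (by omega) hS hSl]
  intro x y hx hy
  rw [eval_schurLift]
  set N : Matrix (Fin (m + l)) (Fin (m + l)) ℂ := Matrix.of fun i j => x (i, j) with hN
  set M : Matrix (Fin (m + l)) (Fin (m + l)) ℂ := Matrix.of fun i j => (x + y) (i, j) with hM
  have hlt : ∀ c ∈ S, c.1 < m ∧ c.2 < m := fun c hc => by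
    simpa using Finset.mem_product.1 (hSm hc)
  have hy1 : ∀ i j, y (Fin.natAdd m i, j) = 0 := fun i j => hy _ fun h => by
    have := (hlt _ h).1
    simp at this
  have hy2 : ∀ i j, y (i, Fin.natAdd m j) = 0 := fun i j => hy _ fun h => by
    have := (hlt _ h).2
    simp at this
  have hT : M.submatrix (Fin.natAdd m) (Fin.natAdd m) =
      N.submatrix (Fin.natAdd m) (Fin.natAdd m) := by
    ext i j
    simp [hM, hN, hy1]
  have hB : M.submatrix (Fin.castAdd l) (Fin.natAdd m) =
      N.submatrix (Fin.castAdd l) (Fin.natAdd m) := by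
    ext i j
    simp [hM, hN, hy2]
  have hD : M.submatrix (Fin.natAdd m) (Fin.castAdd l) =
      N.submatrix (Fin.natAdd m) (Fin.castAdd l) := by
    ext i j
    simp [hM, hN, hy1]
  -- The rank bound needs an invertible block; in the singular case the determinant factor of the
  -- lift vanishes.
  by_cases hdet : (N.submatrix (Fin.natAdd m) (Fin.natAdd m)).det = 0
  · rw [hT, hdet, zero_mul]
  · refine mul_eq_zero_of_right _ ?_
    have hE : (fun p : Fin m × Fin m => schurNumerator M p.1 p.2) =
        (fun p => schurNumerator N p.1 p.2) + fun p =>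
          (N.submatrix (Fin.natAdd m) (Fin.natAdd m)).det *
            y (Fin.castAdd l p.1, Fin.castAdd l p.2) := by
      funext p
      rw [Pi.add_apply, schurNumerator, schurNumerator, hT, hB, hD]
      simp only [Matrix.sub_apply, Matrix.smul_apply, smul_eq_mul, Matrix.submatrix_apply, hM, hN,
        Matrix.of_apply, Pi.add_apply]
      ring
    rw [hE]
    refine hf _ _ (rank_schurNumerator_le N hdet hx) fun p hp => ?_
    rw [hy _ (by simpa using hp), mul_zero]

end Matrices

end RigidityJoin

/-! ### The linear degree bound. -/

theorem mainTheorem9 (k : ℕ) (hk : 2 ≤ k) (S : Finset (ℕ × ℕ)) (hS : S.card = k ^ 2 - 1) :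
    ∃ C : ℝ, ∀ n : ℕ, k < n → S ⊆ Finset.range n ×ˢ Finset.range n →
      RigidityJoin.IsHypersurface
        (RigidityJoin.join (RigidityJoin.sigma (n - k) n) (RigidityJoin.entrySpace S n)) →
      ∃ d : ℕ,
        RigidityJoin.HasHypersurfaceDegree
          (RigidityJoin.join (RigidityJoin.sigma (n - k) n) (RigidityJoin.entrySpace S n)) d ∧
        (d : ℝ) ≤ C * n := by
  classical
  have hcard : 1 < S.card := by
    have : 2 ^ 2 ≤ k ^ 2 := Nat.pow_le_pow_left hk 2
    omega
  have hprincipal : ∀ n : ℕ, k < n → S ⊆ Finset.range n ×ˢ Finset.range n →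
      RigidityJoin.IsHypersurface
        (RigidityJoin.join (RigidityJoin.sigma (n - k) n) (RigidityJoin.entrySpace S n)) →
      ∃ P, P ≠ 0 ∧ RigidityJoin.idealOf (RigidityJoin.join (RigidityJoin.sigma (n - k) n)
        (RigidityJoin.entrySpace S n)) = Ideal.span {P} := by
    intro n hkn hSn hn
    have : Nontrivial (Fin n) := Fin.nontrivial_iff_two_le.2 (by omega)
    have : Nonempty (Fin n) := ⟨⟨0, by omega⟩⟩
    exact hn.exists_idealOf_eq_span
      (RigidityJoin.idealOf_join_isPrime (by omega) (by omega) hcard hSn)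
  by_cases hex : ∃ n : ℕ, k < n ∧ S ⊆ Finset.range n ×ˢ Finset.range n ∧
      RigidityJoin.IsHypersurface
        (RigidityJoin.join (RigidityJoin.sigma (n - k) n) (RigidityJoin.entrySpace S n))
  swap
  · exact ⟨0, fun n h1 h2 h3 => absurd ⟨n, h1, h2, h3⟩ hex⟩
  -- Taking the least admissible size makes `f` depend only on `k` and `S`, and every other
  -- admissible size is `m + l`.
  obtain ⟨hkm, hSm, hm⟩ := Nat.find_spec hex
  have hmin := fun n => Nat.find_min' hex (m := n)
  generalize Nat.find hex = m at hkm hSm hm hmin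
  obtain ⟨f, hf0, hf⟩ := hprincipal m hkm hSm hm
  -- With `n = m + l ≥ 1`, `l ≤ n` and `l + 2 ≤ 3 * n` turn `l + deg f * (l + 2)` into this multiple
  -- of `n`.
  refine ⟨3 * f.totalDegree + 1, fun n hkn hSn hn => ?_⟩
  obtain ⟨P, hP0, hP⟩ := hprincipal n hkn hSn hn
  refine ⟨P.totalDegree, ⟨P, hP0, RigidityJoin.isHomogeneous_of_idealOf_eq_span hP, hP⟩, ?_⟩
  obtain ⟨l, rfl⟩ := Nat.exists_eq_add_of_le (hmin n ⟨hkn, hSn, hn⟩)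
  have hmem := RigidityJoin.schurLift_mem_idealOf_join l (by omega) (by omega) hcard hSm
    (hf ▸ Ideal.mem_span_singleton_self f)
  rw [← Nat.sub_add_comm hkm.le, hP, Ideal.mem_span_singleton] at hmem
  have hdeg := (MvPolynomial.totalDegree_le_of_dvd_of_isDomain hmem
    (RigidityJoin.schurLift_ne_zero hf0)).trans (RigidityJoin.totalDegree_schurLift_le f)
  have hle : l + f.totalDegree * (l + 2) ≤ (3 * f.totalDegree + 1) * (m + l) := by
    have : f.totalDegree * (l + 2) ≤ f.totalDegree * (3 * (m + l)) :=
      Nat.mul_le_mul_left _ (by omega)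
    nlinarith
  exact_mod_cast hdeg.trans hle
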